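/- Let $d\in\mathbb N$ and let $X\subset\mathbb R^d$ be a compact set with $\overline{\operatorname{int}X}=X$ such that $X$ is convex, or $\partial X$ is smooth (of class $C^1$ suffices), or, more generally, $X$ satisfies the cone condition: there are $\gamma\in(0,\pi/2)$ and $l>0$ such that every $x\in\partial X$ is the vertex of an open cone of half-angle $\gamma$ and altitude $l$ contained in $\operatorname{int}X$. Let $\Phi=\{\phi_n:n\in\mathbb N\}$ be an infinite autonomous conformal iterated function system on $X$, that is, a sequence of maps $\phi_n:X\to X$ with the following properties, where $\phi_w:=\phi_{w_1}\circ\dots\circ\phi_{w_k}$ for a finite word $w=w_1\dots w_k\in\mathbb N^k$: 1. (open set condition) $\phi_a(\operatorname{int}X)\cap\phi_b(\operatorname{int}X)=\emptyset$ for $a\neq b$; 2. (conformality) there is an open connected set $V\supset X$ such that every $\phi_n$ extends to a $C^1$ conformal diffeomorphism of $V$ into $V$ (orientation-reversing maps are allowed); 3. (bounded distortion) there is $K\ge1$ such that $\|D\phi_w(x)\|\le K\|D\phi_w(y)\|$ for all nonempty finite words $w$ and all $x,y\in V$; 4. (uniform contraction) there are $\eta\in[0,1)$ and $N\in\mathbb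 N$ such that $\|D\phi_w(x)\|\le\eta^m$ for all $m\ge N$, all words $w$ of length $m+1$ and all $x\in X$. Let $$J(\Phi)=\bigcap_{n\ge1}\ \bigcup_{w\in\mathbb N^n}\phi_w(X)$$ be the limit set of $\Phi$, and for $\omega\in\mathbb N^{\mathbb N}$ let $\pi_\Phi(\omega)$ be the point given by $\{\pi_\Phi(\omega)\}=\bigcap_{n\ge1}\phi_{\omega_1\dots\omega_n}(X)$. Let $\sigma:\mathbb N^{\mathbb N}\to\mathbb N^{\mathbb N}$, $\sigma(\omega)_n=\omega_{n+1}$, be the shift map, and, with the product topology on $\mathbb N^{\mathbb N}$, put $$I^\infty_{\mathrm{dense}}=\bigl\{\omega\in\mathbb N^{\mathbb N}:\overline{\{\sigma^n(\omega):n\ge0\}}=\mathbb N^{\mathbb N}\bigr\},\qquad J_{\mathrm{dense}}(\Phi)=\pi_\Phi\bigl(I^\infty_{\mathrm{dense}}\bigr).$$ Then the Hausdorff dimensions agree: $$\dim_H J_{\mathrm{dense}}(\Phi)=\dim_H J(\Phi).$$ -/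

import Mathlib

open Set

/-- `X ⊆ ℝᵈ` has `C¹` (in particular, possibly `C^∞`) boundary: near every boundary point, `X` is
the sublevel set `{f ≤ 0}` of a `C¹` function `f` whose derivative does not vanish there. -/
def HasC1Boundary {d : ℕ} (X : Set (EuclideanSpace ℝ (Fin d))) : Prop :=
  ∀ p ∈ frontier X, ∃ (U : Set (EuclideanSpace ℝ (Fin d))) (f : EuclideanSpace ℝ (Fin d) → ℝ),
    IsOpen U ∧ p ∈ U ∧ ContDiffOn ℝ 1 f U ∧ fderiv ℝ f p ≠ 0 ∧ X ∩ U = {x ∈ U | f x ≤ 0}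

/-- The cone condition: there are a half-angle `γ` and an altitude `l` such that every boundary
point of `X` is the vertex of an open cone of half-angle `γ` and altitude `l` (with some axis `u`)
contained in the interior of `X`. -/
def HasConeCondition {d : ℕ} (X : Set (EuclideanSpace ℝ (Fin d))) : Prop :=
  ∃ γ l : ℝ, 0 < γ ∧ γ < Real.pi / 2 ∧ 0 < l ∧
    ∀ x ∈ frontier X, ∃ u : EuclideanSpace ℝ (Fin d), ‖u‖ = 1 ∧
      {y | Real.cos γ * ‖y - x‖ < inner ℝ u (y - x) ∧ inner ℝ u (y - x) < l} ⊆ interior X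

/-- The composition `φ_{w₁} ∘ ⋯ ∘ φ_{wₙ}` attached to a finite word `w = w₁ ⋯ wₙ`. -/
def wordMap {I E : Type*} (φ : I → E → E) : List I → E → E
  | [] => id
  | i :: w => φ i ∘ wordMap φ w

/-- `(φ i)_{i ∈ I}` is an autonomous conformal iterated function system on `X ⊆ ℝᵈ`. Each `φ i` is
given as a function on all of `ℝᵈ`: on the neighbourhood `V` of `X` it is the conformal extension
of the map `X → X`, and its values outside `V` are irrelevant. -/
structure IsConformalIFS {d : ℕ} {I : Type*} (X : Set (EuclideanSpace ℝ (Fin d)))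
    (φ : I → EuclideanSpace ℝ (Fin d) → EuclideanSpace ℝ (Fin d)) : Prop where
  isCompact : IsCompact X
  closure_interior : closure (interior X) = X
  geometry : Convex ℝ X ∨ HasC1Boundary X ∨ HasConeCondition X
  mapsTo : ∀ i, MapsTo (φ i) X X
  /-- open set condition -/
  openSet : ∀ a b, a ≠ b → Disjoint (φ a '' interior X) (φ b '' interior X)
  /-- conformality and bounded distortion, on a common neighbourhood `V` of `X` -/
  conformal : ∃ V : Set (EuclideanSpace ℝ (Fin d)), IsOpen V ∧ IsConnected V ∧ X ⊆ V ∧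
    (∀ i, MapsTo (φ i) V V ∧ InjOn (φ i) V ∧ ContDiffOn ℝ 1 (φ i) V ∧
      ∀ x ∈ V, ConformalAt (φ i) x) ∧
    ∃ K : ℝ, 1 ≤ K ∧ ∀ w : List I, w ≠ [] → ∀ x ∈ V, ∀ y ∈ V,
      ‖fderiv ℝ (wordMap φ w) x‖ ≤ K * ‖fderiv ℝ (wordMap φ w) y‖
  /-- uniform contraction -/
  contraction : ∃ (η : ℝ) (N : ℕ), 0 ≤ η ∧ η < 1 ∧ ∀ m ≥ N, ∀ w : List I, w.length = m + 1 →
    ∀ x ∈ X, ‖fderiv ℝ (wordMap φ w) x‖ ≤ η ^ m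

/-- The limit set `J(Φ) = ⋂_{n ≥ 1} ⋃_{w ∈ Iⁿ} φ_w(X)`. -/
def limitSet {I E : Type*} (X : Set E) (φ : I → E → E) : Set E :=
  ⋂ (n : ℕ) (_ : 1 ≤ n), ⋃ (w : List I) (_ : w.length = n), wordMap φ w '' X

/-- `x` is the point `π_Φ(ω)` coded by `ω`, that is, `⋂_{n ≥ 1} φ_{ω|n}(X) = {x}`. -/
def IsCodedBy {I E : Type*} (X : Set E) (φ : I → E → E) (ω : ℕ → I) (x : E) : Prop :=
  ⋂ (n : ℕ) (_ : 1 ≤ n), wordMap φ ((List.range n).map ω) '' X = {x}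

/-- The shift map on sequences. -/
def shift {I : Type*} (ω : ℕ → I) : ℕ → I := fun n => ω (n + 1)

/-- The sequences whose forward orbit under the shift is dense in `ℕ^ℕ` (product topology). -/
def denseSequences : Set (ℕ → ℕ) := {ω | Dense (range fun n : ℕ => shift^[n] ω)}

/-- `J_dense(Φ) = π_Φ(I^∞_dense)`. -/
def denseLimitSet {E : Type*} (X : Set E) (φ : ℕ → E → E) : Set E :=
  {x | ∃ ω ∈ denseSequences, IsCodedBy X φ ω x}

/-! Only the lower bound needs an argument: it suffices that `s ≤ dimH (denseLimitSet X φ)` whenever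
`s > 0` and the limit set has infinite `s`-dimensional Hausdorff measure. Fix `x₀ ∈ interior X` and
call `‖Dφ_w(x₀)‖` the size of `w`; by bounded distortion it is multiplicative up to `K` and controls
the diameter and the volume of the image.

Covering by cylinders of equal length shows that the sums of the `s`-th powers of sizes are
unbounded (`exists_finset_le_sum`), so some finite set `F` of words of one length has a sum of at
least `4 * (K ^ 2) ^ s`. Consider the codes `a₀ t₀ a₁ t₁ ⋯` with `aⱼ ∈ F` free and `t` a fixed
enumeration of all finite words. Every such code has a dense orbit. The words `tⱼ` shrink the
cylinders without contributing mass, but padding `t` with empty words keeps the accumulated loss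
below `2 ^ j` (`exists_surjective_prod_le_two_pow`).

Give the letters `a ∈ F` Bernoulli weights proportional to the `s`-th powers of their sizes. The
surplus factor `4` gives mass at most `4 ^ (-j)` times loss times size to the power `s` at level
`j`. To bound the mass of a ball of radius `r`, stop each code when its size first drops to `r` or
below. Words stopped at one level have equal length, so their images of `interior X` are disjoint
and a volume count bounds their number (`exists_card_mul_pow_le`). The levels sum geometrically, and
the mass distribution principle concludes. -/

open Filter Topology MeasureTheory
open scoped ENNReal NNReal

/-! ### Conformal linear maps: norm and determinant. -/

section ConformalLinear

variable {E : Type*} [NormedAddCommGroup E] [InnerProductSpace ℝ E]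

theorem IsConformalMap.norm_apply [Nontrivial E] {A : E →L[ℝ] E} (hA : IsConformalMap A) (v : E) :
    ‖A v‖ = ‖A‖ * ‖v‖ := by
  obtain ⟨c, -, li, rfl⟩ := hA
  simp [norm_smul, LinearIsometry.norm_toContinuousLinearMap]

theorem IsConformalMap.norm_pos [Nontrivial E] {A : E →L[ℝ] E} (hA : IsConformalMap A) :
    0 < ‖A‖ := norm_pos_iff.2 hA.ne_zero

theorem IsConformalMap.norm_comp [Nontrivial E] {A B : E →L[ℝ] E} (hA : IsConformalMap A)
    (hB : IsConformalMap B) : ‖A.comp B‖ = ‖A‖ * ‖B‖ := by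
  obtain ⟨v, hv⟩ := exists_ne (0 : E)
  have h := (hA.comp hB).norm_apply v
  rw [ContinuousLinearMap.comp_apply, hA.norm_apply, hB.norm_apply, ← mul_assoc] at h
  exact (mul_right_cancel₀ (norm_ne_zero_iff.2 hv) h).symm

theorem IsConformalMap.range_eq_top [FiniteDimensional ℝ E] {A : E →L[ℝ] E}
    (hA : IsConformalMap A) : A.range = ⊤ :=
  LinearMap.range_eq_top.2 (LinearMap.injective_iff_surjective.1 hA.injective)

/-- The unit ball is carried onto the ball of radius `‖A‖`; comparing Haar measures gives the
determinant. -/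
theorem IsConformalMap.abs_det [Nontrivial E] [FiniteDimensional ℝ E] {A : E →L[ℝ] E}
    (hA : IsConformalMap A) : |A.det| = ‖A‖ ^ Module.finrank ℝ E := by
  borelize E
  let μ : Measure E := Measure.addHaar
  have hpos := hA.norm_pos
  have himg : A '' Metric.ball 0 1 = Metric.ball 0 ‖A‖ := by
    ext y
    simp only [mem_image, Metric.mem_ball, dist_zero_right]
    constructor
    · rintro ⟨x, hx, rfl⟩
      rw [hA.norm_apply]
      nlinarith
    · intro hy
      obtain ⟨x, rfl⟩ := LinearMap.range_eq_top.1 hA.range_eq_top y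
      refine ⟨x, ?_, rfl⟩
      rw [ContinuousLinearMap.coe_coe, hA.norm_apply] at hy
      nlinarith
  have h1 := Measure.addHaar_image_continuousLinearMap μ A (Metric.ball 0 1)
  rw [himg, Measure.addHaar_ball μ 0 hpos.le] at h1
  have h2 := (ENNReal.mul_left_inj (Metric.measure_ball_pos μ (0 : E) one_pos).ne'
    measure_ball_lt_top.ne).1 h1
  exact ((ENNReal.ofReal_eq_ofReal_iff (by positivity) (abs_nonneg _)).1 h2).symm

end ConformalLinear

/-! ### Word maps and bounded distortion. -/

theorem wordMap_append {I E : Type*} (φ : I → E → E) (v w : List I) :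
    wordMap φ (v ++ w) = wordMap φ v ∘ wordMap φ w := by
  induction v with
  | nil => rfl
  | cons a v ih => simp only [List.cons_append, wordMap, ih, Function.comp_assoc]

theorem mapsTo_wordMap {I E : Type*} {φ : I → E → E} {s : Set E} (h : ∀ i, MapsTo (φ i) s s)
    (w : List I) : MapsTo (wordMap φ w) s s := by
  induction w with
  | nil => exact mapsTo_id s
  | cons a w ih => exact (h a).comp ih

theorem injOn_wordMap {I E : Type*} {φ : I → E → E} {s : Set E} (h : ∀ i, MapsTo (φ i) s s)
    (hi : ∀ i, InjOn (φ i) s) (w : List I) : InjOn (wordMap φ w) s := by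
  induction w with
  | nil => exact injOn_id s
  | cons a w ih => exact (hi a).comp ih (mapsTo_wordMap h w)

/-- A family of conformal `C¹` embeddings of a connected open neighbourhood `V` of the compact
set `X` into itself, with bounded distortion and the open set condition. -/
structure IsConformalFamily {I E : Type*} [NormedAddCommGroup E] [InnerProductSpace ℝ E]
    (X V : Set E) (φ : I → E → E) (K : ℝ) : Prop where
  isCompact : IsCompact X
  isOpen : IsOpen V
  isPreconnected : IsPreconnected V
  subset : X ⊆ V
  mapsTo_X : ∀ i, MapsTo (φ i) X X
  mapsTo : ∀ i, MapsTo (φ i) V V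
  injOn : ∀ i, InjOn (φ i) V
  contDiffOn : ∀ i, ContDiffOn ℝ 1 (φ i) V
  conformalAt : ∀ i, ∀ x ∈ V, ConformalAt (φ i) x
  disjoint : ∀ a b, a ≠ b → Disjoint (φ a '' interior X) (φ b '' interior X)
  one_le : 1 ≤ K
  distortion : ∀ w : List I, ∀ x ∈ V, ∀ y ∈ V,
    ‖fderiv ℝ (wordMap φ w) x‖ ≤ K * ‖fderiv ℝ (wordMap φ w) y‖

namespace IsConformalFamily

variable {I E : Type*} [NormedAddCommGroup E] [InnerProductSpace ℝ E]
  {X V : Set E} {φ : I → E → E} {K : ℝ}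

theorem word_mapsTo (h : IsConformalFamily X V φ K) (w : List I) :
    MapsTo (wordMap φ w) V V := mapsTo_wordMap h.mapsTo w

theorem word_mapsTo_X (h : IsConformalFamily X V φ K) (w : List I) :
    MapsTo (wordMap φ w) X X := mapsTo_wordMap h.mapsTo_X w

theorem word_injOn (h : IsConformalFamily X V φ K) (w : List I) :
    InjOn (wordMap φ w) V := injOn_wordMap h.mapsTo h.injOn w

theorem word_contDiffOn (h : IsConformalFamily X V φ K) (w : List I) :
    ContDiffOn ℝ 1 (wordMap φ w) V := by
  induction w with
  | nil => exact contDiffOn_id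
  | cons a w ih => exact (h.contDiffOn a).comp ih (h.word_mapsTo w)

theorem word_contDiffAt (h : IsConformalFamily X V φ K) (w : List I) {x : E} (hx : x ∈ V) :
    ContDiffAt ℝ 1 (wordMap φ w) x :=
  (h.word_contDiffOn w).contDiffAt (h.isOpen.mem_nhds hx)

theorem word_differentiableAt (h : IsConformalFamily X V φ K) (w : List I) {x : E} (hx : x ∈ V) :
    DifferentiableAt ℝ (wordMap φ w) x :=
  (h.word_contDiffAt w hx).differentiableAt one_ne_zero

theorem word_conformalAt (h : IsConformalFamily X V φ K) (w : List I) {x : E} (hx : x ∈ V) :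
    ConformalAt (wordMap φ w) x := by
  induction w with
  | nil => exact conformalAt_id x
  | cons a w ih => exact (h.conformalAt a _ (h.word_mapsTo w hx)).comp x ih

theorem isConformalMap_fderiv (h : IsConformalFamily X V φ K) (w : List I) {x : E} (hx : x ∈ V) :
    IsConformalMap (fderiv ℝ (wordMap φ w) x) :=
  conformalAt_iff_isConformalMap_fderiv.1 (h.word_conformalAt w hx)

theorem norm_fderiv_pos [Nontrivial E] (h : IsConformalFamily X V φ K) (w : List I) {x : E}
    (hx : x ∈ V) : 0 < ‖fderiv ℝ (wordMap φ w) x‖ :=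
  (h.isConformalMap_fderiv w hx).norm_pos

theorem norm_fderiv_append [Nontrivial E] (h : IsConformalFamily X V φ K) (v w : List I) {x : E}
    (hx : x ∈ V) : ‖fderiv ℝ (wordMap φ (v ++ w)) x‖ =
      ‖fderiv ℝ (wordMap φ v) (wordMap φ w x)‖ * ‖fderiv ℝ (wordMap φ w) x‖ := by
  have hwx := h.word_mapsTo w hx
  rw [wordMap_append, fderiv_comp x (h.word_differentiableAt v hwx) (h.word_differentiableAt w hx),
    (h.isConformalMap_fderiv v hwx).norm_comp (h.isConformalMap_fderiv w hx)]

theorem mul_le_norm_fderiv_append [Nontrivial E] (h : IsConformalFamily X V φ K) (v w : List I)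
    {x : E} (hx : x ∈ V) : ‖fderiv ℝ (wordMap φ v) x‖ * ‖fderiv ℝ (wordMap φ w) x‖ ≤
      K * ‖fderiv ℝ (wordMap φ (v ++ w)) x‖ := by
  rw [h.norm_fderiv_append v w hx, ← mul_assoc]
  gcongr
  exact h.distortion v x hx _ (h.word_mapsTo w hx)

/-- On the compact set `X`, each word map is Lipschitz with constant comparable to the norm of
its derivative at any given point. -/
theorem exists_dist_le (h : IsConformalFamily X V φ K) {x₀ : E} (hx₀ : x₀ ∈ X) :
    ∃ C : ℝ, 0 < C ∧ ∀ w, ∀ x ∈ X, ∀ y ∈ X,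
      dist (wordMap φ w x) (wordMap φ w y) ≤ C * ‖fderiv ℝ (wordMap φ w) x₀‖ := by
  have hx₀V := h.subset hx₀
  have hK : 0 < K := one_pos.trans_le h.one_le
  -- On a ball inside `V`, this is the mean value inequality with the distortion bound.
  have hball : ∀ x ∈ V, ∃ δ > 0, Metric.ball x δ ⊆ V ∧ ∀ w, ∀ y ∈ Metric.ball x δ,
      ∀ z ∈ Metric.ball x δ, dist (wordMap φ w y) (wordMap φ w z) ≤
        (K * (2 * δ)) * ‖fderiv ℝ (wordMap φ w) x₀‖ := by
    intro x hx
    obtain ⟨δ, hδ, hsub⟩ := Metric.isOpen_iff.1 h.isOpen x hx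
    refine ⟨δ, hδ, hsub, fun w y hy z hz => ?_⟩
    have := (convex_ball x δ).norm_image_sub_le_of_norm_fderiv_le (𝕜 := ℝ) (f := wordMap φ w)
      (C := K * ‖fderiv ℝ (wordMap φ w) x₀‖)
      (fun u hu => h.word_differentiableAt w (hsub hu))
      (fun u hu => h.distortion w u (hsub hu) x₀ hx₀V) hz hy
    rw [dist_eq_norm]
    refine this.trans ?_
    have hyz : ‖y - z‖ ≤ 2 * δ := by
      rw [← dist_eq_norm]
      have := dist_triangle_right y z x
      rw [Metric.mem_ball] at hy hz
      linarith
    calc _ ≤ K * ‖fderiv ℝ (wordMap φ w) x₀‖ * (2 * δ) := by gcongr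
      _ = _ := by ring
  -- `V` need not be convex, so points are joined by chains of balls. The constant depends on the
  -- point but not on `w`; compactness of `X` then removes the dependence on the point.
  have hpair : ∀ x ∈ V, ∃ L : ℝ, ∀ w, dist (wordMap φ w x₀) (wordMap φ w x) ≤
      L * ‖fderiv ℝ (wordMap φ w) x₀‖ := by
    intro x hx
    refine h.isPreconnected.induction₂ (fun a b => ∃ L : ℝ, ∀ w, dist (wordMap φ w a)
      (wordMap φ w b) ≤ L * ‖fderiv ℝ (wordMap φ w) x₀‖) ?_ ?_ ?_ hx₀V hx
    · intro a ha
      obtain ⟨δ, hδ, -, hd⟩ := hball a ha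
      filter_upwards [mem_nhdsWithin_of_mem_nhds (Metric.ball_mem_nhds a hδ)] with b hb
      exact ⟨_, fun w => hd w a (Metric.mem_ball_self hδ) b hb⟩
    · rintro a b c - - - ⟨L, hL⟩ ⟨L', hL'⟩
      refine ⟨L + L', fun w => (dist_triangle _ (wordMap φ w b) _).trans ?_⟩
      rw [add_mul]
      exact add_le_add (hL w) (hL' w)
    · rintro a b - - ⟨L, hL⟩
      exact ⟨L, fun w => by rw [dist_comm]; exact hL w⟩
  have hX : ∃ L : ℝ, ∀ x ∈ X, ∀ w, dist (wordMap φ w x₀) (wordMap φ w x) ≤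
      L * ‖fderiv ℝ (wordMap φ w) x₀‖ := by
    refine h.isCompact.induction_on (p := fun s => ∃ L : ℝ, ∀ x ∈ s, ∀ w,
      dist (wordMap φ w x₀) (wordMap φ w x) ≤ L * ‖fderiv ℝ (wordMap φ w) x₀‖)
      ⟨0, by simp⟩ ?_ ?_ ?_
    · rintro s t hst ⟨L, hL⟩
      exact ⟨L, fun x hx => hL x (hst hx)⟩
    · rintro s t ⟨L, hL⟩ ⟨L', hL'⟩
      refine ⟨max L L', ?_⟩
      rintro x (hx | hx) w
      · exact (hL x hx w).trans (by gcongr; exact le_max_left _ _)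
      · exact (hL' x hx w).trans (by gcongr; exact le_max_right _ _)
    · intro x hx
      obtain ⟨L, hL⟩ := hpair x (h.subset hx)
      obtain ⟨δ, hδ, -, hd⟩ := hball x (h.subset hx)
      refine ⟨Metric.ball x δ, mem_nhdsWithin_of_mem_nhds (Metric.ball_mem_nhds x hδ),
        L + K * (2 * δ), fun y hy w => (dist_triangle _ (wordMap φ w x) _).trans ?_⟩
      rw [add_mul]
      exact add_le_add (hL w) (hd w x (Metric.mem_ball_self hδ) y hy)
  obtain ⟨L, hL⟩ := hX
  refine ⟨max (2 * L) 1, by positivity, fun w x hx y hy => ?_⟩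
  calc _ ≤ dist (wordMap φ w x₀) (wordMap φ w x) + dist (wordMap φ w x₀) (wordMap φ w y) :=
        dist_triangle_left _ _ _
    _ ≤ 2 * L * ‖fderiv ℝ (wordMap φ w) x₀‖ := by linarith [hL x hx w, hL y hy w]
    _ ≤ _ := by gcongr; exact le_max_left _ _

/-! ### Disjointness and volume of cylinder images. -/

section FiniteDimensional

variable [FiniteDimensional ℝ E]

/-- The derivative is invertible, so a word map sends neighbourhoods to neighbourhoods. -/
theorem word_mapsTo_interior (h : IsConformalFamily X V φ K) (w : List I) :
    MapsTo (wordMap φ w) (interior X) (interior X) := by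
  intro x hx
  have hxV := h.subset (interior_subset hx)
  have hmap := ((h.word_contDiffAt w hxV).hasStrictFDerivAt one_ne_zero).map_nhds_eq_of_surj
    (h.isConformalMap_fderiv w hxV).range_eq_top
  rw [mem_interior_iff_mem_nhds, ← hmap, mem_map]
  filter_upwards [mem_interior_iff_mem_nhds.1 hx] with y hy
  exact h.word_mapsTo_X w hy

theorem disjoint_word_image (h : IsConformalFamily X V φ K) {v w : List I}
    (hlen : v.length = w.length) (hvw : v ≠ w) :
    Disjoint (wordMap φ v '' interior X) (wordMap φ w '' interior X) := by
  induction v generalizing w with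
  | nil => exact absurd (List.length_eq_zero_iff.1 hlen.symm).symm hvw
  | cons a v ih =>
    cases w with
    | nil => simp at hlen
    | cons b w =>
      simp only [wordMap, image_comp]
      have hint : ∀ u, wordMap φ u '' interior X ⊆ interior X :=
        fun u => (h.word_mapsTo_interior u).image_subset
      -- A common first letter cancels by injectivity on `V`; distinct first letters are separated
      -- by the open set condition.
      by_cases hab : a = b
      · subst hab
        have hV : ∀ u, ∀ x ∈ wordMap φ u '' interior X, x ∈ V :=
          fun u x hx => h.subset (interior_subset (hint u hx))
        refine disjoint_left.2 ?_
        rintro _ ⟨x, hx, rfl⟩ ⟨y, hy, hyx⟩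
        have hxy := h.injOn a (hV w y hy) (hV v x hx) hyx
        exact disjoint_left.1 (ih (by simpa using hlen) (by simpa using hvw)) hx (hxy ▸ hy)
      · exact (h.disjoint a b hab).mono (image_mono (hint v)) (image_mono (hint w))

variable [Nontrivial E] [MeasurableSpace E] [BorelSpace E]

theorem le_addHaar_image (h : IsConformalFamily X V φ K) (μ : Measure E) [μ.IsAddHaarMeasure]
    (w : List I) {x₀ : E} (hx₀ : x₀ ∈ V) :
    ENNReal.ofReal ((‖fderiv ℝ (wordMap φ w) x₀‖ / K) ^ Module.finrank ℝ E) * μ (interior X) ≤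
      μ (wordMap φ w '' interior X) := by
  have hsub : interior X ⊆ V := interior_subset.trans h.subset
  have hK : 0 < K := one_pos.trans_le h.one_le
  rw [← lintegral_abs_det_fderiv_eq_addHaar_image μ isOpen_interior.measurableSet
    (fun x hx => (h.word_differentiableAt w (hsub hx)).hasFDerivAt.hasFDerivWithinAt)
    ((h.word_injOn w).mono hsub), ← setLIntegral_const]
  refine setLIntegral_mono' isOpen_interior.measurableSet fun x hx => ?_
  rw [(h.isConformalMap_fderiv w (hsub hx)).abs_det]
  gcongr
  rw [div_le_iff₀' hK]
  exact h.distortion w x₀ hx₀ x (hsub hx)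

/-- The number of words of a common length whose images meet a ball of radius `r` and have size
between `κ * r` and `r` is at most a constant multiple of `κ ^ (-dim E)`. -/
theorem exists_card_mul_pow_le (h : IsConformalFamily X V φ K) {x₀ : E} (hx₀ : x₀ ∈ interior X) :
    ∃ M : ℝ, 0 ≤ M ∧ ∀ (T : Finset (List I)) (m : ℕ) (x : E) (r κ : ℝ), 0 < r → 0 ≤ κ →
      (∀ w ∈ T, w.length = m ∧ κ * r ≤ ‖fderiv ℝ (wordMap φ w) x₀‖ ∧
        ‖fderiv ℝ (wordMap φ w) x₀‖ ≤ r ∧ (wordMap φ w '' X ∩ Metric.closedBall x r).Nonempty) →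
      T.card * κ ^ Module.finrank ℝ E ≤ M := by
  have hx₀X := interior_subset hx₀
  have hK : 0 < K := one_pos.trans_le h.one_le
  obtain ⟨C, hC, hdist⟩ := h.exists_dist_le hx₀X
  let μ : Measure E := Measure.addHaar
  set n := Module.finrank ℝ E
  set b := (μ (Metric.closedBall (0 : E) 1)).toReal
  set i := (μ (interior X)).toReal
  have hitop : μ (interior X) ≠ ∞ :=
    ((measure_mono interior_subset).trans_lt h.isCompact.measure_lt_top).ne
  have hi : 0 < i := ENNReal.toReal_pos
    (isOpen_interior.measure_pos μ ⟨x₀, hx₀⟩).ne' hitop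
  -- The constant compares the volume of a ball of radius `(1 + C) * r`, which contains all the
  -- images, with the lower bound `(κ * r / K) ^ n * i` for each of these disjoint images.
  refine ⟨(1 + C) ^ n * b * K ^ n / i, by positivity, fun T m x r κ hr hκ hT => ?_⟩
  have hsub : ∀ w ∈ T, wordMap φ w '' interior X ⊆ Metric.closedBall x ((1 + C) * r) := by
    rintro w hw _ ⟨y, hy, rfl⟩
    obtain ⟨-, -, hle, ⟨_, ⟨z, hz, rfl⟩, hzb⟩⟩ := hT w hw
    rw [Metric.mem_closedBall] at hzb ⊢
    have h1 := dist_triangle (wordMap φ w y) (wordMap φ w z) x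
    have h2 := hdist w y (interior_subset hy) z hz
    have h3 : C * ‖fderiv ℝ (wordMap φ w) x₀‖ ≤ C * r := by gcongr
    linarith
  have hmeas : ∀ w ∈ T, MeasurableSet (wordMap φ w '' interior X) := fun w _ =>
    measurable_image_of_fderivWithin isOpen_interior.measurableSet
      (fun y hy => (h.word_differentiableAt w
        (h.subset (interior_subset hy))).hasFDerivAt.hasFDerivWithinAt)
      ((h.word_injOn w).mono (interior_subset.trans h.subset))
  have hvol : ∑ w ∈ T, μ (wordMap φ w '' interior X) ≤
      μ (Metric.closedBall x ((1 + C) * r)) := by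
    rw [← measure_biUnion_finset _ hmeas]
    · exact measure_mono (iUnion₂_subset hsub)
    · intro v hv w hw hvw
      exact h.disjoint_word_image ((hT v hv).1.trans (hT w hw).1.symm) hvw
  have hlow : (T.card : ℝ≥0∞) * (ENNReal.ofReal ((κ * r / K) ^ n) * μ (interior X)) ≤
      μ (Metric.closedBall x ((1 + C) * r)) := by
    refine le_trans ?_ hvol
    rw [← nsmul_eq_mul]
    refine Finset.card_nsmul_le_sum _ _ _ fun w hw => ?_
    refine le_trans ?_ (h.le_addHaar_image μ w (h.subset hx₀X))
    gcongr
    exact (hT w hw).2.1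
  rw [Measure.addHaar_closedBall' μ x (by positivity)] at hlow
  have hreal := ENNReal.toReal_mono
    (ENNReal.mul_ne_top ENNReal.ofReal_ne_top measure_closedBall_lt_top.ne) hlow
  simp only [ENNReal.toReal_mul, ENNReal.toReal_natCast] at hreal
  rw [ENNReal.toReal_ofReal (by positivity), ENNReal.toReal_ofReal (by positivity)] at hreal
  rw [le_div_iff₀ hi]
  have hrn : 0 < r ^ n := by positivity
  have hKn : 0 < K ^ n := by positivity
  refine le_of_mul_le_mul_right ?_ hrn
  rw [div_pow, mul_pow, mul_pow] at hreal
  have h5 : (T.card : ℝ) * κ ^ n * i * r ^ n =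
      (T.card * (κ ^ n * r ^ n / K ^ n * i)) * K ^ n := by field_simp
  rw [h5]
  calc _ ≤ ((1 + C) ^ n * r ^ n * b) * K ^ n := by gcongr
    _ = _ := by ring

end FiniteDimensional

end IsConformalFamily

/-! ### Slow enumeration and splicing of words. -/

/-- A countable family can be enumerated, with repetitions of an element of weight `1`, so slowly
that the products of the weights grow at most like the powers of `2`. -/
theorem exists_surjective_prod_le_two_pow {α : Type*} [Countable α] (q : α → ℝ) (e : α)
    (he : q e = 1) (hq : ∀ x, 1 ≤ q x) :
    ∃ t : ℕ → α, Function.Surjective t ∧ ∀ j, ∏ i ∈ Finset.range j, q (t i) ≤ 2 ^ j := by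
  classical
  have : Nonempty α := ⟨e⟩
  obtain ⟨u, hu⟩ := exists_surjective_nat α
  -- `n k` is the position given to `u k`: late enough for `2 ^ n k` to dominate all weights up to
  -- `u k`. The `+ 1` makes `n` strictly increasing; every other position gets `e`.
  let n : ℕ → ℕ := fun k => ∑ i ∈ Finset.range (k + 1), (⌈q (u i)⌉₊ + 1)
  have hn : StrictMono n := strictMono_nat_of_lt_succ fun k => by
    simp only [n]
    rw [Finset.sum_range_succ _ (k + 1)]
    omega
  have hprod : ∀ k, ∏ i ∈ Finset.range (k + 1), q (u i) ≤ 2 ^ n k := by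
    intro k
    simp only [n]
    rw [← Finset.prod_pow_eq_pow_sum]
    refine Finset.prod_le_prod (fun i _ => zero_le_one.trans (hq _)) fun i _ => ?_
    calc q (u i) ≤ (⌈q (u i)⌉₊ : ℝ) := Nat.le_ceil _
      _ ≤ 2 ^ ⌈q (u i)⌉₊ := by exact_mod_cast Nat.lt_two_pow_self.le
      _ ≤ _ := pow_le_pow_right₀ one_le_two (Nat.le_succ _)
  let t : ℕ → α := fun j => if hj : ∃ k, n k = j then u hj.choose else e
  have htn : ∀ k, t (n k) = u k := by
    intro k
    have hk : ∃ k', n k' = n k := ⟨k, rfl⟩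
    simp only [t, dif_pos hk]
    exact congrArg u (hn.injective hk.choose_spec)
  refine ⟨t, fun x => (hu x).elim fun k hk => ⟨n k, (htn k).trans hk⟩, fun j => ?_⟩
  -- The indices placed before position `j`; searching below `j` suffices because `k ≤ n k`.
  set S := (Finset.range j).filter fun k => n k < j with hS
  have hST : ∏ i ∈ Finset.range j, q (t i) = ∏ k ∈ S, q (u k) := by
    have h1 : ∏ k ∈ S, q (u k) = ∏ i ∈ S.image n, q (t i) := by
      rw [Finset.prod_image fun x _ y _ hxy => hn.injective hxy]
      exact Finset.prod_congr rfl fun k _ => by rw [htn]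
    rw [h1]
    refine (Finset.prod_subset ?_ ?_).symm
    · intro i hi
      obtain ⟨k, hk, rfl⟩ := Finset.mem_image.1 hi
      exact Finset.mem_range.2 (Finset.mem_filter.1 hk).2
    · intro i hi hiS
      have hne : ¬ ∃ k, n k = i := by
        rintro ⟨k, rfl⟩
        rw [Finset.mem_range] at hi
        exact hiS (Finset.mem_image_of_mem n
          (Finset.mem_filter.2 ⟨Finset.mem_range.2 ((hn.id_le k).trans_lt hi), hi⟩))
      simp only [t, dif_neg hne, he]
  rw [hST]
  rcases S.eq_empty_or_nonempty with h0 | h0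
  · rw [h0, Finset.prod_empty]
    exact one_le_pow₀ one_le_two
  · have hmax := Finset.mem_filter.1 (S.max'_mem h0)
    calc ∏ k ∈ S, q (u k) ≤ ∏ k ∈ Finset.range (S.max' h0 + 1), q (u k) := by
          have hsub : S ⊆ Finset.range (S.max' h0 + 1) := fun k hk =>
            Finset.mem_range.2 (Nat.lt_succ_of_le (S.le_max' k hk))
          rw [← Finset.prod_sdiff hsub]
          refine le_mul_of_one_le_left
            (Finset.prod_nonneg fun k _ => zero_le_one.trans (hq _)) ?_
          calc (1 : ℝ) = ∏ k ∈ Finset.range (S.max' h0 + 1) \ S, 1 := by simp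
            _ ≤ _ := Finset.prod_le_prod (fun _ _ => zero_le_one) fun k _ => hq _
      _ ≤ 2 ^ n (S.max' h0) := hprod _
      _ ≤ 2 ^ j := pow_le_pow_right₀ one_le_two hmax.2.le

/-- The word `a₀ t₀ a₁ t₁ ⋯ aⱼ₋₁ tⱼ₋₁` obtained from two sequences of words. -/
def spliceWord {I : Type*} (t a : ℕ → List I) : ℕ → List I
  | 0 => []
  | j + 1 => spliceWord t a j ++ (a j ++ t j)

/-- The infinite sequence `a₀ t₀ a₁ t₁ ⋯` obtained from two sequences of words. -/
def spliceSeq {I : Type*} [Inhabited I] (t a : ℕ → List I) (k : ℕ) : I :=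
  -- If no `a j` is empty, the word has length at least `k + 1` and the default is never used.
  (spliceWord t a (k + 1)).getD k default

section Splice

variable {I : Type*} {t a b : ℕ → List I}

theorem spliceWord_prefix {i j : ℕ} (hij : i ≤ j) : spliceWord t a i <+: spliceWord t a j := by
  induction j, hij using Nat.le_induction with
  | base => exact List.prefix_rfl
  | succ j _ ih => exact ih.trans (List.prefix_append _ _)

theorem le_length_spliceWord (ha : ∀ j, a j ≠ []) (j : ℕ) : j ≤ (spliceWord t a j).length := by
  induction j with
  | zero => exact Nat.zero_le _
  | succ j ih =>
    have := List.length_pos_iff.2 (ha j)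
    simp only [spliceWord, List.length_append]
    omega

theorem length_spliceWord_congr (h : ∀ j, (a j).length = (b j).length) (j : ℕ) :
    (spliceWord t a j).length = (spliceWord t b j).length := by
  induction j with
  | zero => rfl
  | succ j ih => simp only [spliceWord, List.length_append, ih, h j]

/-- Known block lengths make the splicing uniquely decodable, so a spliced word determines a
Bernoulli cylinder. -/
theorem eq_of_spliceWord_eq (h : ∀ j, (a j).length = (b j).length) {j : ℕ}
    (hj : spliceWord t a j = spliceWord t b j) {i : ℕ} (hi : i < j) : a i = b i := by
  induction j with
  | zero => exact absurd hi (Nat.not_lt_zero i)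
  | succ j ih =>
    obtain ⟨h1, h2⟩ := List.append_inj hj (length_spliceWord_congr h j)
    rcases Nat.lt_succ_iff_lt_or_eq.1 hi with hlt | rfl
    · exact ih h1 hlt
    · exact (List.append_inj h2 (h i)).1

theorem finite_range_spliceWord {A : Type*} [Finite A] (ι : A → List I) (j : ℕ) :
    (range fun c : ℕ → A => spliceWord t (ι ∘ c) j).Finite := by
  induction j with
  | zero => exact (finite_singleton []).subset (by rintro _ ⟨c, rfl⟩; rfl)
  | succ j ih =>
    refine (ih.image2 (fun v w => v ++ (w ++ t j)) (finite_range ι)).subset ?_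
    rintro _ ⟨c, rfl⟩
    exact ⟨_, ⟨c, rfl⟩, _, ⟨c j, rfl⟩, rfl⟩

variable [Inhabited I]

theorem spliceSeq_eq_getElem (ha : ∀ j, a j ≠ []) {j k : ℕ} (hk : k < (spliceWord t a j).length) :
    spliceSeq t a k = (spliceWord t a j)[k] := by
  have hk' : k < (spliceWord t a (k + 1)).length := le_length_spliceWord ha (k + 1)
  rw [spliceSeq, List.getD_eq_getElem _ _ hk']
  rcases le_total (k + 1) j with h | h
  · exact (spliceWord_prefix h).getElem hk'
  · exact ((spliceWord_prefix h).getElem hk).symm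

theorem map_spliceSeq_range (ha : ∀ j, a j ≠ []) (j : ℕ) :
    (List.range (spliceWord t a j).length).map (spliceSeq t a) = spliceWord t a j := by
  refine List.ext_getElem (by simp) fun k _ hk => ?_
  rw [List.getElem_map, List.getElem_range, spliceSeq_eq_getElem ha hk]

end Splice

theorem shift_iterate_apply {I : Type*} (ω : ℕ → I) (n k : ℕ) : shift^[n] ω k = ω (n + k) := by
  induction n generalizing ω with
  | zero => simp
  | succ n ih =>
    rw [Function.iterate_succ_apply, ih, shift]
    congr 1
    omega

/-- Every finite word occurs as some `t j`, so some shift of the sequence enters any given cylinder.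
-/
theorem spliceSeq_mem_denseSequences {t a : ℕ → List ℕ} (ha : ∀ j, a j ≠ [])
    (ht : Function.Surjective t) : spliceSeq t a ∈ denseSequences := by
  intro ω
  refine mem_closure_iff.2 fun o ho hωo => ?_
  obtain ⟨_, ⟨x, m, rfl⟩, hωx, hxo⟩ :=
    (PiNat.isTopologicalBasis_cylinders (fun _ : ℕ => ℕ)).exists_subset_of_mem_open hωo ho
  obtain ⟨j, hj⟩ := ht ((List.range m).map x)
  refine ⟨_, hxo fun i hi => ?_, ⟨(spliceWord t a j ++ a j).length, rfl⟩⟩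
  have hw : spliceWord t a (j + 1) = (spliceWord t a j ++ a j) ++ (List.range m).map x := by
    rw [spliceWord, hj, List.append_assoc]
  change shift^[_] (spliceSeq t a) i = x i
  rw [shift_iterate_apply, spliceSeq_eq_getElem ha (j := j + 1)
    (by simp only [hw, List.length_append, List.length_map, List.length_range]; omega)]
  simp only [hw]
  rw [List.getElem_append_right (Nat.le_add_right _ _)]
  simp

/-! ### Bernoulli measures and the mass of cylinders and balls. -/

/-- There is a Bernoulli measure on `ℕ → A` with given positive weights. -/
theorem exists_bernoulli_measure {A : Type*} [Fintype A] [MeasurableSpace A]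
    [MeasurableSingletonClass A] (p : A → ℝ) (hp : ∀ c, 0 ≤ p c) (hsum : ∑ c, p c = 1) :
    ∃ μ : Measure (ℕ → A), IsProbabilityMeasure μ ∧ ∀ (c : ℕ → A) (j : ℕ),
      μ {c' | ∀ i < j, c' i = c i} = ENNReal.ofReal (∏ i ∈ Finset.range j, p (c i)) := by
  let P : PMF A := PMF.ofFintype (fun c => ENNReal.ofReal (p c)) (by
    rw [← ENNReal.ofReal_sum_of_nonneg fun c _ => hp c, hsum, ENNReal.ofReal_one])
  refine ⟨Measure.infinitePi fun _ => P.toMeasure, inferInstance, fun c j => ?_⟩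
  have hset : {c' : ℕ → A | ∀ i < j, c' i = c i} =
      Set.pi (Finset.range j : Set ℕ) fun i => {c i} := by
    ext c'
    simp [Set.mem_pi]
  rw [hset, Measure.infinitePi_pi _ fun i _ => measurableSet_singleton _,
    ENNReal.ofReal_prod_of_nonneg fun i _ => hp _]
  refine Finset.prod_congr rfl fun i _ => ?_
  rw [PMF.toMeasure_apply_singleton _ _ (measurableSet_singleton _), PMF.ofFintype_apply]

namespace IsConformalFamily

variable {I E : Type*} [NormedAddCommGroup E] [InnerProductSpace ℝ E] [Nontrivial E]
  {X V : Set E} {φ : I → E → E} {K : ℝ}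

theorem norm_fderiv_nil (x : E) : ‖fderiv ℝ (wordMap φ []) x‖ = 1 := by
  change ‖fderiv ℝ id x‖ = 1
  rw [fderiv_id]
  exact ContinuousLinearMap.norm_id

theorem norm_fderiv_spliceWord_succ (h : IsConformalFamily X V φ K) {x₀ : E} (hx₀ : x₀ ∈ V)
    (t a : ℕ → List I) (j : ℕ) :
    ‖fderiv ℝ (wordMap φ (spliceWord t a j)) x₀‖ * (‖fderiv ℝ (wordMap φ (a j)) x₀‖ *
      ‖fderiv ℝ (wordMap φ (t j)) x₀‖) ≤
    K ^ 2 * ‖fderiv ℝ (wordMap φ (spliceWord t a (j + 1))) x₀‖ := by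
  have hK : 0 < K := one_pos.trans_le h.one_le
  calc _ ≤ ‖fderiv ℝ (wordMap φ (spliceWord t a j)) x₀‖ *
        (K * ‖fderiv ℝ (wordMap φ (a j ++ t j)) x₀‖) := by
        refine mul_le_mul_of_nonneg_left ?_ (norm_nonneg _)
        exact h.mul_le_norm_fderiv_append _ _ hx₀
    _ = K * (‖fderiv ℝ (wordMap φ (spliceWord t a j)) x₀‖ *
        ‖fderiv ℝ (wordMap φ (a j ++ t j)) x₀‖) := by ring
    _ ≤ K * (K * ‖fderiv ℝ (wordMap φ (spliceWord t a (j + 1))) x₀‖) := by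
        refine mul_le_mul_of_nonneg_left ?_ hK.le
        exact h.mul_le_norm_fderiv_append _ _ hx₀
    _ = _ := by ring

/-- Each splice costs `K ^ 2` by two uses of near-multiplicativity, and omitting `t i` costs at most
the factor `max 1 ‖·‖⁻¹`. -/
theorem prod_norm_fderiv_le (h : IsConformalFamily X V φ K) {x₀ : E} (hx₀ : x₀ ∈ V)
    (t a : ℕ → List I) (j : ℕ) :
    ∏ i ∈ Finset.range j, ‖fderiv ℝ (wordMap φ (a i)) x₀‖ ≤
      (K ^ 2) ^ j * (∏ i ∈ Finset.range j, max 1 ‖fderiv ℝ (wordMap φ (t i)) x₀‖⁻¹) *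
        ‖fderiv ℝ (wordMap φ (spliceWord t a j)) x₀‖ := by
  induction j with
  | zero => simp [spliceWord, norm_fderiv_nil]
  | succ j ih =>
    rw [Finset.prod_range_succ, Finset.prod_range_succ]
    have hsucc := h.norm_fderiv_spliceWord_succ hx₀ t a j
    set q := max 1 ‖fderiv ℝ (wordMap φ (t j)) x₀‖⁻¹
    set Q := ∏ i ∈ Finset.range j, max 1 ‖fderiv ℝ (wordMap φ (t i)) x₀‖⁻¹
    have hQ : 0 ≤ Q := Finset.prod_nonneg fun i _ => by positivity
    have hτ := h.norm_fderiv_pos (t j) hx₀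
    have hqτ : 1 ≤ ‖fderiv ℝ (wordMap φ (t j)) x₀‖ * q :=
      calc 1 = ‖fderiv ℝ (wordMap φ (t j)) x₀‖ * ‖fderiv ℝ (wordMap φ (t j)) x₀‖⁻¹ :=
            (mul_inv_cancel₀ hτ.ne').symm
        _ ≤ _ := by gcongr; exact le_max_right _ _
    have hq : 0 ≤ q := by positivity
    set α := ‖fderiv ℝ (wordMap φ (a j)) x₀‖
    have hα0 : 0 ≤ α := norm_nonneg _
    calc _ ≤ ((K ^ 2) ^ j * Q * ‖fderiv ℝ (wordMap φ (spliceWord t a j)) x₀‖) * α := by gcongr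
      _ ≤ ((K ^ 2) ^ j * Q * ‖fderiv ℝ (wordMap φ (spliceWord t a j)) x₀‖) * α *
          (‖fderiv ℝ (wordMap φ (t j)) x₀‖ * q) := le_mul_of_one_le_right (by positivity) hqτ
      _ = (K ^ 2) ^ j * Q * q * (‖fderiv ℝ (wordMap φ (spliceWord t a j)) x₀‖ *
          (α * ‖fderiv ℝ (wordMap φ (t j)) x₀‖)) := by ring
      _ ≤ (K ^ 2) ^ j * Q * q *
          (K ^ 2 * ‖fderiv ℝ (wordMap φ (spliceWord t a (j + 1))) x₀‖) := by gcongr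
      _ = _ := by ring

/-- A Bernoulli measure for which every cylinder, coded by a spliced word, has mass at most the
`s`-th power of the size of its image, up to a factor that the tails determine. -/
theorem exists_measure_cylinder_le (h : IsConformalFamily X V φ K) {x₀ : E} (hx₀ : x₀ ∈ V)
    {s : ℝ} (hs : 0 < s) {A : Type*} [Fintype A] [MeasurableSpace A] [MeasurableSingletonClass A]
    (ι : A → List I) (hι : Function.Injective ι) {n : ℕ} (hn : ∀ c, (ι c).length = n)
    (hsum : 4 * (K ^ 2) ^ s ≤ ∑ c, ‖fderiv ℝ (wordMap φ (ι c)) x₀‖ ^ s) (t : ℕ → List I) :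
    ∃ μ : Measure (ℕ → A), IsProbabilityMeasure μ ∧ ∀ (w : List I) (j : ℕ),
      μ {c | spliceWord t (ι ∘ c) j = w} ≤ ENNReal.ofReal ((1 / 4) ^ j *
        (∏ i ∈ Finset.range j, max 1 ‖fderiv ℝ (wordMap φ (t i)) x₀‖⁻¹) ^ s *
          ‖fderiv ℝ (wordMap φ w) x₀‖ ^ s) := by
  have hK : 0 < K := one_pos.trans_le h.one_le
  have hK2 : 0 < (K ^ 2) ^ s := by positivity
  set Z := ∑ c, ‖fderiv ℝ (wordMap φ (ι c)) x₀‖ ^ s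
  have hZ : 0 < Z := lt_of_lt_of_le (by positivity) hsum
  obtain ⟨μ, hμ, hcyl⟩ := exists_bernoulli_measure
    (fun c => ‖fderiv ℝ (wordMap φ (ι c)) x₀‖ ^ s / Z) (fun c => by positivity)
    (by rw [← Finset.sum_div, div_self hZ.ne'])
  refine ⟨μ, hμ, fun w j => ?_⟩
  by_cases hw : ∃ c, spliceWord t (ι ∘ c) j = w
  · obtain ⟨c, rfl⟩ := hw
    have hsub : {c' | spliceWord t (ι ∘ c') j = spliceWord t (ι ∘ c) j} ⊆
        {c' | ∀ i < j, c' i = c i} := fun c' hc' i hi =>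
      hι (eq_of_spliceWord_eq (fun k => (hn (c' k)).trans (hn (c k)).symm) hc' hi)
    refine (measure_mono hsub).trans ?_
    rw [hcyl]
    refine ENNReal.ofReal_le_ofReal ?_
    set Q := ∏ i ∈ Finset.range j, max 1 ‖fderiv ℝ (wordMap φ (t i)) x₀‖⁻¹
    have hQ : 0 ≤ Q := Finset.prod_nonneg fun i _ => by positivity
    set D := ‖fderiv ℝ (wordMap φ (spliceWord t (ι ∘ c) j)) x₀‖
    have hprod := h.prod_norm_fderiv_le hx₀ t (ι ∘ c) j
    rw [Finset.prod_div_distrib, Finset.prod_const, Finset.card_range,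
      Real.finsetProd_rpow _ _ fun i _ => norm_nonneg _]
    calc _ ≤ ((K ^ 2) ^ j * Q * D) ^ s / Z ^ j := by gcongr; exact hprod
      _ = ((K ^ 2) ^ s / Z) ^ j * Q ^ s * D ^ s := by
        rw [Real.mul_rpow (by positivity) (norm_nonneg _), Real.mul_rpow (by positivity) hQ,
          div_pow, Real.rpow_pow_comm (by positivity)]
        ring
      _ ≤ _ := by
        -- The threshold `4 * (K ^ 2) ^ s` absorbs the distortion and leaves a factor `1 / 4` per
        -- level.
        have hKZ : (K ^ 2) ^ s / Z ≤ 1 / 4 := by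
          rw [div_le_div_iff₀ hZ (by norm_num)]
          linarith
        gcongr
  · have : {c | spliceWord t (ι ∘ c) j = w} = ∅ :=
      eq_empty_of_forall_notMem fun c hc => hw ⟨c, hc⟩
    rw [this, measure_empty]
    exact zero_le

variable [FiniteDimensional ℝ E]

/-- The ball estimate of the mass distribution principle. -/
theorem exists_measure_closedBall_le (h : IsConformalFamily X V φ K) {x₀ : E}
    (hx₀ : x₀ ∈ interior X) {s : ℝ} (hs : 0 < s) {A : Type*} [Fintype A] [Nonempty A]
    [MeasurableSpace A] [MeasurableSingletonClass A]
    (ι : A → List I) (hι : Function.Injective ι) {n : ℕ} (hn : ∀ c, (ι c).length = n)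
    (hsum : 4 * (K ^ 2) ^ s ≤ ∑ c, ‖fderiv ℝ (wordMap φ (ι c)) x₀‖ ^ s) (t : ℕ → List I)
    (ht : ∀ j, ∏ i ∈ Finset.range j, (max 1 ‖fderiv ℝ (wordMap φ (t i)) x₀‖⁻¹) ^
      (s + Module.finrank ℝ E) ≤ 2 ^ j)
    (π : (ℕ → A) → E) (hπ : ∀ c j, π c ∈ wordMap φ (spliceWord t (ι ∘ c) j) '' X)
    (hlim : ∀ c, Tendsto (fun j => ‖fderiv ℝ (wordMap φ (spliceWord t (ι ∘ c) j)) x₀‖) atTop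
      (𝓝 0)) :
    ∃ μ : Measure (ℕ → A), IsProbabilityMeasure μ ∧ ∃ C : ℝ, 0 ≤ C ∧ ∀ x r, 0 < r → r < 1 →
      μ {c | π c ∈ Metric.closedBall x r} ≤ ENNReal.ofReal (C * r ^ s) := by
  have hx₀V := h.subset (interior_subset hx₀)
  have hK : 0 < K := one_pos.trans_le h.one_le
  borelize E
  obtain ⟨μ, hμ, hcyl⟩ := h.exists_measure_cylinder_le hx₀V hs ι hι hn hsum t
  obtain ⟨M, hM, hcard⟩ := h.exists_card_mul_pow_le hx₀
  obtain ⟨c₀, hc₀⟩ := Finite.exists_min fun c => ‖fderiv ℝ (wordMap φ (ι c)) x₀‖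
  set d := Module.finrank ℝ E
  set m := ‖fderiv ℝ (wordMap φ (ι c₀)) x₀‖
  have hm : 0 < m := h.norm_fderiv_pos _ hx₀V
  set q : ℕ → ℝ := fun i => max 1 ‖fderiv ℝ (wordMap φ (t i)) x₀‖⁻¹ with hqdef
  have hq1 : ∀ i, 1 ≤ q i := fun i => le_max_left _ _
  have hq0 : ∀ i, 0 < q i := fun i => one_pos.trans_le (hq1 i)
  refine ⟨μ, hμ, M / (m / K ^ 2) ^ d, by positivity, fun x r hr hr1 => ?_⟩
  set B := Metric.closedBall x r
  have hfin : ∀ j, {w | ∃ c, spliceWord t (ι ∘ c) (j + 1) = w ∧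
      ‖fderiv ℝ (wordMap φ (spliceWord t (ι ∘ c) (j + 1))) x₀‖ ≤ r ∧
      r < ‖fderiv ℝ (wordMap φ (spliceWord t (ι ∘ c) j)) x₀‖ ∧ π c ∈ B}.Finite := fun j =>
    (finite_range_spliceWord (t := t) ι (j + 1)).subset fun w ⟨c, hc, _⟩ => ⟨c, hc⟩
  -- The words, for codes of points in the ball, whose size first becomes at most `r` at level `j +
  -- 1`. Level `0` is never the first, since the empty word has size `1 > r`.
  set T : ℕ → Finset (List I) := fun j => (hfin j).toFinset
  have hcover : {c | π c ∈ B} ⊆ ⋃ j, ⋃ w ∈ T j, {c | spliceWord t (ι ∘ c) (j + 1) = w} := by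
    intro c hc
    have hex : ∃ k, ‖fderiv ℝ (wordMap φ (spliceWord t (ι ∘ c) k)) x₀‖ ≤ r :=
      ((hlim c).eventually_le_const hr).exists
    classical
    obtain ⟨j, hj⟩ : ∃ j, Nat.find hex = j + 1 := by
      refine Nat.exists_eq_succ_of_ne_zero fun h0 => ?_
      have := Nat.find_spec hex
      rw [h0, spliceWord, norm_fderiv_nil] at this
      linarith
    have hle := Nat.find_spec hex
    rw [hj] at hle
    have hlt := Nat.find_min hex (m := j) (by omega)
    simp only [mem_iUnion]
    exact ⟨j, _, (hfin j).mem_toFinset.2 ⟨c, rfl, hle, not_le.1 hlt, hc⟩, rfl⟩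
  have hTcard : ∀ j, ((T j).card : ℝ) ≤ M / (m / K ^ 2) ^ d * q j ^ d := by
    intro j
    -- One more splice shrinks the size by a factor of at least `κ = m / K ^ 2 / q j`, with `m` the
    -- smallest size of a letter; hence stopped words have size at least `κ * r`.
    have := hcard (T j) (spliceWord t (ι ∘ fun _ => c₀) (j + 1)).length x r (m / K ^ 2 / q j) hr
      (by have := hq0 j; positivity) ?_
    · rw [div_pow] at this
      have h1 : 0 < (m / K ^ 2) ^ d := by positivity
      have h2 : 0 < q j ^ d := pow_pos (hq0 j) d
      rw [mul_div_assoc', div_le_iff₀ h2] at this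
      rw [div_mul_eq_mul_div, le_div_iff₀ h1]
      exact this
    · intro w hw
      obtain ⟨c, rfl, hle, hlt, hc⟩ := (hfin j).mem_toFinset.1 hw
      refine ⟨length_spliceWord_congr (fun k => (hn _).trans (hn _).symm) _, ?_, hle,
        π c, hπ c _, hc⟩
      have hsucc := h.norm_fderiv_spliceWord_succ hx₀V t (ι ∘ c) j
      have hτ := h.norm_fderiv_pos (t j) hx₀V
      have hqτ : (q j)⁻¹ ≤ ‖fderiv ℝ (wordMap φ (t j)) x₀‖ := by
        rw [inv_le_comm₀ (hq0 j) hτ]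
        exact le_max_right _ _
      have hqi : 0 < (q j)⁻¹ := inv_pos.2 (hq0 j)
      have : r * (m * (q j)⁻¹) ≤
          K ^ 2 * ‖fderiv ℝ (wordMap φ (spliceWord t (ι ∘ c) (j + 1))) x₀‖ := by
        refine le_trans ?_ hsucc
        gcongr
        exact hc₀ (c j)
      rw [div_div, div_mul_eq_mul_div, div_le_iff₀ (by have := hq0 j; positivity)]
      calc m * r = r * (m * (q j)⁻¹) * q j := by field_simp [(hq0 j).ne']
        _ ≤ K ^ 2 * ‖fderiv ℝ (wordMap φ (spliceWord t (ι ∘ c) (j + 1))) x₀‖ * q j := by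
          have := (hq0 j).le
          gcongr
        _ = _ := by ring
  have hlevel : ∀ j, μ (⋃ w ∈ T j, {c | spliceWord t (ι ∘ c) (j + 1) = w}) ≤
      ENNReal.ofReal (M / (m / K ^ 2) ^ d * r ^ s / 2 / 2 ^ j) := by
    intro j
    set Q := ∏ i ∈ Finset.range (j + 1), q i with hQdef
    have hQ0 : 0 < Q := Finset.prod_pos fun i _ => hq0 i
    have hQq : q j ≤ Q := by
      rw [hQdef, Finset.prod_range_succ]
      refine le_mul_of_one_le_left (hq0 j).le ?_
      calc (1 : ℝ) = ∏ i ∈ Finset.range j, 1 := by simp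
        _ ≤ _ := Finset.prod_le_prod (fun _ _ => zero_le_one) fun i _ => hq1 i
    -- The loss enters through the word count (power `d`) and the cylinder mass (power `s`), hence
    -- the exponent `s + d` in `ht`.
    have hQ2 : Q ^ d * Q ^ s ≤ 2 ^ (j + 1) := by
      rw [mul_comm, ← Real.rpow_natCast Q d, ← Real.rpow_add hQ0, hQdef,
        ← Real.finsetProd_rpow _ _ fun i _ => (hq0 i).le]
      exact ht (j + 1)
    calc _ ≤ ∑ w ∈ T j, μ {c | spliceWord t (ι ∘ c) (j + 1) = w} :=
          measure_biUnion_finset_le _ _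
      _ ≤ ∑ w ∈ T j, ENNReal.ofReal ((1 / 4) ^ (j + 1) * Q ^ s * r ^ s) := by
          refine Finset.sum_le_sum fun w hw => (hcyl w (j + 1)).trans ?_
          obtain ⟨c, rfl, hle, -, -⟩ := (hfin j).mem_toFinset.1 hw
          refine ENNReal.ofReal_le_ofReal ?_
          gcongr
      _ = ENNReal.ofReal ((T j).card * ((1 / 4) ^ (j + 1) * Q ^ s * r ^ s)) := by
          rw [Finset.sum_const, nsmul_eq_mul, ENNReal.ofReal_mul (Nat.cast_nonneg _),
            ENNReal.ofReal_natCast]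
      _ ≤ _ := by
          refine ENNReal.ofReal_le_ofReal ?_
          have hC : 0 ≤ M / (m / K ^ 2) ^ d := by positivity
          calc _ ≤ M / (m / K ^ 2) ^ d * q j ^ d * ((1 / 4) ^ (j + 1) * Q ^ s * r ^ s) := by
                gcongr
                exact hTcard j
            _ ≤ M / (m / K ^ 2) ^ d * Q ^ d * ((1 / 4) ^ (j + 1) * Q ^ s * r ^ s) := by
                have := (hq0 j).le
                gcongr
            _ = M / (m / K ^ 2) ^ d * r ^ s * (1 / 4) ^ (j + 1) * (Q ^ d * Q ^ s) := by ring
            _ ≤ M / (m / K ^ 2) ^ d * r ^ s * (1 / 4) ^ (j + 1) * 2 ^ (j + 1) := by gcongr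
            _ = _ := by
                rw [mul_assoc, ← mul_pow, show (1 / 4 : ℝ) * 2 = 2⁻¹ by norm_num, inv_pow, pow_succ]
                field_simp
                ring
  calc _ ≤ ∑' j, μ (⋃ w ∈ T j, {c | spliceWord t (ι ∘ c) (j + 1) = w}) :=
        (measure_mono hcover).trans (measure_iUnion_le _)
    _ ≤ ∑' j, ENNReal.ofReal (M / (m / K ^ 2) ^ d * r ^ s / 2 / 2 ^ j) :=
        ENNReal.tsum_le_tsum hlevel
    _ = _ := by
        rw [← ENNReal.ofReal_tsum_of_nonneg (fun j => by positivity) (summable_geometric_two' _),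
          tsum_geometric_two']

end IsConformalFamily

/-! ### Mass distribution and measurability of the coding. -/

/-- The mass distribution principle. -/
theorem le_dimH_range_of_measure_closedBall_le {Ω E : Type*} [MeasurableSpace Ω] [MetricSpace E]
    [MeasurableSpace E] [BorelSpace E] (μ : Measure Ω) [IsProbabilityMeasure μ] {f : Ω → E}
    (hf : Measurable f) {s : ℝ≥0} {C : ℝ} (hC : 0 ≤ C)
    (hball : ∀ x r, 0 < r → r < 1 →
      μ {ω | f ω ∈ Metric.closedBall x r} ≤ ENNReal.ofReal (C * r ^ (s : ℝ))) :
    (s : ℝ≥0∞) ≤ dimH (range f) := by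
  set c : ℝ≥0∞ := ENNReal.ofReal C + 1
  have hc0 : c ≠ 0 := by simp [c]
  have hc : c ≠ ∞ := by simp [c]
  have hle : c⁻¹ • μ.map f ≤ μH[(s : ℝ)] := by
    refine Measure.le_hausdorffMeasure _ _ (1 / 2) (by simp) fun S hS => ?_
    rcases S.eq_empty_or_nonempty with rfl | ⟨x, hx⟩
    · simp
    have hStop : Metric.ediam S ≠ ∞ := (hS.trans_lt (by norm_num)).ne
    set δ := (Metric.ediam S).toReal with hδ
    have hδ1 : δ < 1 := by
      have : δ ≤ ((1 : ℝ≥0∞) / 2).toReal := ENNReal.toReal_mono (by norm_num) hS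
      norm_num at this
      linarith
    have hδ0 : 0 ≤ δ := ENNReal.toReal_nonneg
    -- The diameter `δ` may vanish, whereas the ball estimate needs a positive radius; so take `r >
    -- δ` and let `r` tend to `δ`.
    have hr : ∀ r, δ < r → r < 1 → μ.map f S ≤ ENNReal.ofReal (C * r ^ (s : ℝ)) := by
      intro r hδr hr1
      have hsub : S ⊆ Metric.closedBall x r := fun y hy =>
        (Metric.dist_le_diam_of_mem (Metric.isBounded_iff_ediam_ne_top.2 hStop) hy hx).trans hδr.le
      calc μ.map f S ≤ μ.map f (Metric.closedBall x r) := measure_mono hsub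
        _ = μ {ω | f ω ∈ Metric.closedBall x r} :=
          Measure.map_apply hf Metric.isClosed_closedBall.measurableSet
        _ ≤ _ := hball x r (hδ0.trans_lt hδr) hr1
    have hlim : Tendsto (fun r : ℝ => ENNReal.ofReal (C * r ^ (s : ℝ))) (𝓝[>] δ)
        (𝓝 (ENNReal.ofReal (C * δ ^ (s : ℝ)))) := by
      refine (ENNReal.continuous_ofReal.tendsto _).comp (Tendsto.const_mul C ?_)
      exact ((Real.continuous_rpow_const s.coe_nonneg).tendsto δ).mono_left nhdsWithin_le_nhds
    have hSδ : μ.map f S ≤ ENNReal.ofReal (C * δ ^ (s : ℝ)) := by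
      refine ge_of_tendsto hlim ?_
      filter_upwards [Ioo_mem_nhdsGT hδ1] with r hr' using hr r hr'.1 hr'.2
    rw [Measure.smul_apply, smul_eq_mul, ENNReal.inv_mul_le_iff hc0 hc]
    refine hSδ.trans ?_
    rw [ENNReal.ofReal_mul hC, ← ENNReal.ofReal_rpow_of_nonneg hδ0 s.coe_nonneg,
      hδ, ENNReal.ofReal_toReal hStop]
    gcongr
    exact le_self_add
  refine le_dimH_of_hausdorffMeasure_ne_zero (ne_of_gt ?_)
  refine lt_of_lt_of_le ?_ (hle (range f))
  rw [Measure.smul_apply, smul_eq_mul]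
  refine ENNReal.mul_pos (ENNReal.inv_ne_zero.2 hc) (ne_of_gt ?_)
  refine lt_of_lt_of_le ?_ (Measure.le_map_apply hf.aemeasurable (range f))
  simp

theorem measurable_apply_spliceWord {I A E : Type*} [Countable I] [Countable A]
    [MeasurableSpace A] [MeasurableSingletonClass A] [MeasurableSpace E]
    (ι : A → List I) (t : ℕ → List I) (j : ℕ) (g : List I → E) :
    Measurable fun c : ℕ → A => g (spliceWord t (ι ∘ c) j) := by
  let _ : MeasurableSpace (List I) := ⊤
  have : DiscreteMeasurableSpace (List I) := ⟨fun _ => trivial⟩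
  refine Measurable.comp (Measurable.of_discrete) ?_
  induction j with
  | zero => exact measurable_const
  | succ j ih =>
    have hg : Measurable fun p : List I × A => p.1 ++ (ι p.2 ++ t j) := Measurable.of_discrete
    exact hg.comp (ih.prodMk (measurable_pi_apply j))

/-! ### Coded points, efficient covers and the lower bound. -/

namespace IsConformalFamily

variable {I E : Type*} [NormedAddCommGroup E] [InnerProductSpace ℝ E]
  {X V : Set E} {φ : I → E → E} {K : ℝ}

/-- Under uniform contraction every sequence codes a point. -/
theorem exists_isCodedBy (h : IsConformalFamily X V φ K) {x₀ : E} (hx₀ : x₀ ∈ X) {η : ℝ} {N : ℕ}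
    (hη0 : 0 ≤ η) (hη1 : η < 1)
    (hD : ∀ k ≥ N, ∀ w : List I, k + 1 ≤ w.length → ‖fderiv ℝ (wordMap φ w) x₀‖ ≤ η ^ k)
    (ω : ℕ → I) : ∃ x, IsCodedBy X φ ω x := by
  obtain ⟨C, hC, hdist⟩ := h.exists_dist_le hx₀
  set S : ℕ → Set E := fun n => wordMap φ ((List.range n).map ω) '' X with hS
  have hanti : ∀ n, S (n + 1) ⊆ S n := by
    intro n
    simp only [hS, List.range_succ, List.map_append, wordMap_append, image_comp]
    exact image_mono (h.word_mapsTo_X _).image_subset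
  have hcomp : ∀ n, IsCompact (S n) := fun n =>
    h.isCompact.image_of_continuousOn ((h.word_contDiffOn _).continuousOn.mono h.subset)
  obtain ⟨x, hx⟩ := IsCompact.nonempty_iInter_of_sequence_nonempty_isCompact_isClosed S hanti
    (fun n => ⟨_, x₀, hx₀, rfl⟩) (hcomp 0) fun n => (hcomp n).isClosed
  rw [mem_iInter] at hx
  refine ⟨x, Subset.antisymm (fun y hy => ?_)
    (singleton_subset_iff.2 (mem_iInter₂.2 fun n _ => hx n))⟩
  rw [mem_iInter₂] at hy
  have hlim : Tendsto (fun k : ℕ => C * η ^ k) atTop (𝓝 0) := by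
    simpa using (tendsto_pow_atTop_nhds_zero_of_lt_one hη0 hη1).const_mul C
  refine dist_le_zero.1 (ge_of_tendsto hlim ?_)
  filter_upwards [eventually_ge_atTop N] with k hk
  obtain ⟨y', hy', rfl⟩ := hy (k + 1) (Nat.le_add_left 1 k)
  obtain ⟨x', hx', rfl⟩ := hx (k + 1)
  refine (hdist _ y' hy' x' hx').trans ?_
  gcongr
  exact hD k hk _ (by simp)

/-- If the limit set has infinite `s`-dimensional Hausdorff measure, then the sums of the `s`-th
powers of the sizes of the cylinders of equal length are unbounded. -/
theorem exists_finset_le_sum [MeasurableSpace E] [BorelSpace E] [Countable I]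
    (h : IsConformalFamily X V φ K) {x₀ : E} (hx₀ : x₀ ∈ X) {η : ℝ} {N : ℕ}
    (hη0 : 0 ≤ η) (hη1 : η < 1)
    (hD : ∀ k ≥ N, ∀ w : List I, k + 1 ≤ w.length → ‖fderiv ℝ (wordMap φ w) x₀‖ ≤ η ^ k)
    {s : ℝ} (hs : 0 ≤ s) (hJ : μH[s] (limitSet X φ) = ∞) (B : ℝ) :
    ∃ n, 1 ≤ n ∧ ∃ F : Finset (List I), (∀ w ∈ F, w.length = n) ∧
      B ≤ ∑ w ∈ F, ‖fderiv ℝ (wordMap φ w) x₀‖ ^ s := by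
  by_contra! hcon
  obtain ⟨C, hC, hdist⟩ := h.exists_dist_le hx₀
  have hdiam : ∀ w, Metric.ediam (wordMap φ w '' X) ≤
      ENNReal.ofReal (C * ‖fderiv ℝ (wordMap φ w) x₀‖) := by
    intro w
    refine Metric.ediam_le ?_
    rintro _ ⟨x, hx, rfl⟩ _ ⟨y, hy, rfl⟩
    rw [edist_dist]
    exact ENNReal.ofReal_le_ofReal (hdist w x hx y hy)
  have hlim : Tendsto (fun k : ℕ => ENNReal.ofReal (C * η ^ k)) atTop (𝓝 0) := by
    rw [← ENNReal.ofReal_zero]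
    refine (ENNReal.continuous_ofReal.tendsto _).comp ?_
    simpa using (tendsto_pow_atTop_nhds_zero_of_lt_one hη0 hη1).const_mul C
  have hle := Measure.hausdorffMeasure_le_liminf_tsum
    (ι := fun k => {w : List I // w.length = k + 1}) s (limitSet X φ) _ hlim
    (fun k w => wordMap φ w.1 '' X)
    (by
      filter_upwards [eventually_ge_atTop N] with k hk w
      refine (hdiam _).trans (ENNReal.ofReal_le_ofReal ?_)
      gcongr
      exact hD k hk _ w.2.ge)
    (Eventually.of_forall fun k x hx => by
      obtain ⟨w, hw, hxw⟩ := mem_iUnion₂.1 (mem_iInter₂.1 hx (k + 1) (Nat.le_add_left 1 k))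
      exact mem_iUnion.2 ⟨⟨w, hw⟩, hxw⟩)
  -- There may be infinitely many words of one length, but the sum is the supremum of its finite
  -- partial sums, which `hcon` bounds.
  have hsum : ∀ k, ∑' w : {w : List I // w.length = k + 1},
      Metric.ediam (wordMap φ w.1 '' X) ^ s ≤ ENNReal.ofReal (C ^ s * B) := by
    intro k
    rw [ENNReal.tsum_eq_iSup_sum]
    refine iSup_le fun F => ?_
    calc ∑ w ∈ F, Metric.ediam (wordMap φ w.1 '' X) ^ s
        ≤ ∑ w ∈ F, ENNReal.ofReal (C ^ s * ‖fderiv ℝ (wordMap φ w.1) x₀‖ ^ s) := by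
          refine Finset.sum_le_sum fun w _ => ?_
          rw [← Real.mul_rpow hC.le (norm_nonneg _),
            ← ENNReal.ofReal_rpow_of_nonneg (by positivity) hs]
          exact ENNReal.rpow_le_rpow (hdiam _) hs
      _ = ENNReal.ofReal (C ^ s * ∑ w ∈ F.map (Function.Embedding.subtype _),
            ‖fderiv ℝ (wordMap φ w) x₀‖ ^ s) := by
          rw [← ENNReal.ofReal_sum_of_nonneg fun w _ => by positivity, Finset.sum_map,
            Finset.mul_sum]
          rfl
      _ ≤ _ := by
          refine ENNReal.ofReal_le_ofReal ?_
          gcongr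
          refine (hcon (k + 1) (Nat.le_add_left 1 k) _ fun w hw => ?_).le
          obtain ⟨v, -, rfl⟩ := Finset.mem_map.1 hw
          exact v.2
  rw [hJ, top_le_iff] at hle
  have hlt : liminf (fun k => ∑' w : {w : List I // w.length = k + 1},
      Metric.ediam (wordMap φ w.1 '' X) ^ s) atTop ≤ ENNReal.ofReal (C ^ s * B) :=
    (liminf_le_liminf (Eventually.of_forall hsum)).trans (liminf_const _).le
  rw [hle] at hlt
  exact ENNReal.ofReal_ne_top (top_le_iff.1 hlt)

/-- The dimension of the set of points with a dense code is at least every exponent for which the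
limit set has infinite Hausdorff measure. -/
theorem le_dimH_denseLimitSet [Nontrivial E] [FiniteDimensional ℝ E] [MeasurableSpace E]
    [BorelSpace E] {φ : ℕ → E → E} (h : IsConformalFamily X V φ K) {x₀ : E}
    (hx₀ : x₀ ∈ interior X) {η : ℝ} {N : ℕ} (hη0 : 0 ≤ η) (hη1 : η < 1)
    (hD : ∀ k ≥ N, ∀ w : List ℕ, k + 1 ≤ w.length → ‖fderiv ℝ (wordMap φ w) x₀‖ ≤ η ^ k)
    {s : ℝ≥0} (hs : 0 < s) (hJ : μH[s] (limitSet X φ) = ∞) :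
    (s : ℝ≥0∞) ≤ dimH (denseLimitSet X φ) := by
  have hx₀X := interior_subset hx₀
  have hK : 0 < K := one_pos.trans_le h.one_le
  obtain ⟨C, hC, hdist⟩ := h.exists_dist_le hx₀X
  obtain ⟨n, hn, F, hFn, hF⟩ :=
    h.exists_finset_le_sum hx₀X hη0 hη1 hD s.coe_nonneg hJ (4 * (K ^ 2) ^ (s : ℝ))
  let _ : MeasurableSpace F := ⊤
  have : DiscreteMeasurableSpace F := ⟨fun _ => trivial⟩
  have hne : F.Nonempty := by
    rw [Finset.nonempty_iff_ne_empty]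
    rintro rfl
    have : 0 < 4 * (K ^ 2) ^ (s : ℝ) := by positivity
    simp only [Finset.sum_empty] at hF
    linarith
  have : Nonempty F := hne.to_subtype
  obtain ⟨t, ht, hprod⟩ := exists_surjective_prod_le_two_pow
    (fun w : List ℕ => (max 1 ‖fderiv ℝ (wordMap φ w) x₀‖⁻¹) ^ ((s : ℝ) + Module.finrank ℝ E)) []
    (by simp [norm_fderiv_nil]) (fun w => Real.one_le_rpow (le_max_left _ _) (by positivity))
  let ι : F → List ℕ := Subtype.val
  have hι : ∀ (c : ℕ → F) (j : ℕ), (ι ∘ c) j ≠ [] := fun c j hcj => by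
    have := hFn _ (c j).2
    simp only [Function.comp_apply, ι] at hcj
    rw [hcj] at this
    simp at this
    omega
  choose π hπ using fun c : ℕ → F =>
    h.exists_isCodedBy hx₀X hη0 hη1 hD (spliceSeq t (ι ∘ c))
  have hmem : ∀ c j, π c ∈ wordMap φ (spliceWord t (ι ∘ c) (j + 1)) '' X := by
    intro c j
    have h1 := le_length_spliceWord (t := t) (hι c) (j + 1)
    have h2 : π c ∈ ⋂ (m : ℕ) (_ : 1 ≤ m),
        wordMap φ ((List.range m).map (spliceSeq t (ι ∘ c))) '' X := by
      rw [hπ c]; exact mem_singleton _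
    have h3 := mem_iInter₂.1 h2 _ ((Nat.le_add_left 1 j).trans h1)
    rwa [map_spliceSeq_range (hι c)] at h3
  have hmem' : ∀ c j, π c ∈ wordMap φ (spliceWord t (ι ∘ c) j) '' X := by
    rintro c (_ | j)
    · obtain ⟨y, hy, hyx⟩ := hmem c 0
      exact ⟨π c, hyx ▸ h.word_mapsTo_X _ hy, rfl⟩
    · exact hmem c j
  have hlim : ∀ c, Tendsto (fun j => ‖fderiv ℝ (wordMap φ (spliceWord t (ι ∘ c) j)) x₀‖) atTop
      (𝓝 0) := by
    intro c
    rw [← tendsto_add_atTop_iff_nat 1]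
    refine squeeze_zero' (Eventually.of_forall fun _ => norm_nonneg _) ?_
      (tendsto_pow_atTop_nhds_zero_of_lt_one hη0 hη1)
    filter_upwards [eventually_ge_atTop N] with j hj
    exact hD j hj _ (le_length_spliceWord (hι c) (j + 1))
  obtain ⟨μ, hμ, M, hM, hball⟩ := h.exists_measure_closedBall_le hx₀ (s := s) hs ι
    Subtype.val_injective (fun c => hFn _ c.2)
    (by rw [Finset.sum_coe_sort F fun w => ‖fderiv ℝ (wordMap φ w) x₀‖ ^ (s : ℝ)]; exact hF)
    t hprod π hmem' hlim
  -- `π` is the pointwise limit of the images of `x₀` under the spliced words, each depending on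
  -- finitely many coordinates.
  have hπm : Measurable π := by
    refine measurable_of_tendsto_metrizable (f := fun j c =>
      wordMap φ (spliceWord t (ι ∘ c) j) x₀) (fun j => measurable_apply_spliceWord ι t j
        fun w => wordMap φ w x₀) (tendsto_pi_nhds.2 fun c => ?_)
    rw [tendsto_iff_dist_tendsto_zero]
    refine squeeze_zero (fun _ => dist_nonneg) (fun j => ?_) (by simpa using (hlim c).const_mul C)
    obtain ⟨y, hy, hyx⟩ := hmem' c j
    rw [← hyx]
    exact hdist _ x₀ hx₀X y hy
  refine (le_dimH_range_of_measure_closedBall_le μ hπm hM hball).trans (dimH_mono ?_)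
  rintro _ ⟨c, rfl⟩
  exact ⟨_, spliceSeq_mem_denseSequences (hι c) ht, hπ c⟩

end IsConformalFamily

/-! ### The theorem. -/

theorem denseLimitSet_subset_limitSet {E : Type*} (X : Set E) (φ : ℕ → E → E) :
    denseLimitSet X φ ⊆ limitSet X φ := by
  rintro x ⟨ω, -, hω⟩
  have hx : x ∈ ⋂ (n : ℕ) (_ : 1 ≤ n), wordMap φ ((List.range n).map ω) '' X := by
    rw [hω]; exact mem_singleton x
  exact mem_iInter₂.2 fun n hn => mem_iUnion₂.2 ⟨_, by simp, mem_iInter₂.1 hx n hn⟩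

theorem IsConformalIFS.exists_isConformalFamily {d : ℕ} {I : Type*}
    {X : Set (EuclideanSpace ℝ (Fin d))}
    {φ : I → EuclideanSpace ℝ (Fin d) → EuclideanSpace ℝ (Fin d)} (hΦ : IsConformalIFS X φ) :
    ∃ V K, IsConformalFamily X V φ K := by
  obtain ⟨V, hVo, hVc, hXV, hmaps, K, hK, hdist⟩ := hΦ.conformal
  refine ⟨V, K, hΦ.isCompact, hVo, hVc.isPreconnected, hXV, hΦ.mapsTo, fun i => (hmaps i).1,
    fun i => (hmaps i).2.1, fun i => (hmaps i).2.2.1, fun i => (hmaps i).2.2.2, hΦ.openSet, hK,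
    fun w x hx y hy => ?_⟩
  rcases eq_or_ne w [] with rfl | hw
  · change ‖fderiv ℝ id x‖ ≤ K * ‖fderiv ℝ id y‖
    rw [fderiv_id, fderiv_id]
    exact le_mul_of_one_le_left (norm_nonneg _) hK
  · exact hdist w hw x hx y hy

theorem mainTheorem6 (d : ℕ) (X : Set (EuclideanSpace ℝ (Fin d)))
    (φ : ℕ → EuclideanSpace ℝ (Fin d) → EuclideanSpace ℝ (Fin d))
    (hΦ : IsConformalIFS X φ) :
    dimH (denseLimitSet X φ) = dimH (limitSet X φ) := by
  refine le_antisymm (dimH_mono (denseLimitSet_subset_limitSet X φ)) ?_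
  obtain rfl | hd := Nat.eq_zero_or_pos d
  · rw [dimH_subsingleton (subsingleton_of_subsingleton (s := limitSet X φ))]
    exact zero_le
  have : Nonempty (Fin d) := ⟨⟨0, hd⟩⟩
  obtain ⟨V, K, h⟩ := hΦ.exists_isConformalFamily
  rcases (interior X).eq_empty_or_nonempty with hX | ⟨x₀, hx₀⟩
  · have hX' : X = ∅ := by rw [← hΦ.closure_interior, hX, closure_empty]
    have hJ : limitSet X φ = ∅ := by
      refine eq_empty_of_forall_notMem fun x hx => ?_
      obtain ⟨w, -, y, hy, -⟩ := mem_iUnion₂.1 (mem_iInter₂.1 hx 1 le_rfl)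
      rw [hX'] at hy
      exact hy
    rw [hJ, dimH_empty]
    exact zero_le
  obtain ⟨η, N, hη0, hη1, hcontr⟩ := hΦ.contraction
  -- A word longer than `k + 1` satisfies a bound with a higher power of `η`, which is at most `η ^
  -- k`.
  have hD : ∀ k ≥ N, ∀ w : List ℕ, k + 1 ≤ w.length →
      ‖fderiv ℝ (wordMap φ w) x₀‖ ≤ η ^ k := by
    intro k hk w hw
    obtain ⟨m, hm⟩ := Nat.exists_eq_add_of_le hw
    refine (hcontr (k + m) (by omega) w (by omega) x₀ (interior_subset hx₀)).trans ?_
    exact pow_le_pow_of_le_one hη0 hη1.le (Nat.le_add_right k m)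
  refine dimH_le fun s hJ => ?_
  rcases eq_or_ne s 0 with rfl | hs
  · exact zero_le
  · exact h.le_dimH_denseLimitSet hx₀ hη0 hη1 hD (pos_iff_ne_zero.2 hs) hJ
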